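/- Let $[n]=\{1,\dots,n\}$, order $\mathbb{R}^n$ coordinatewise, and write $\lambda+x=(\lambda+x_i)_{i\in[n]}$. A non-empty set $E\subset\mathbb{R}^n$ is an \emph{ambitropical cone} if $\lambda+x\in E$ for all $x\in E$, $\lambda\in\mathbb{R}$, and $E$ is a lattice in the induced order (joins and meets being taken in $E$). An \emph{alcoved polyhedron} is a set $\{x\in\mathbb{R}^n\mid x_i\ge M_{ij}+x_j\ \forall i,j\in[n]\}$ with $M\in(\mathbb{R}\cup\{-\infty\})^{n\times n}$. An \emph{ambitropical polyhedron} is an ambitropical cone that is a finite union of alcoved polyhedra. A \emph{Shapley operator} is a map $T:\mathbb{R}^n\to\mathbb{R}^n$ that is order preserving and satisfies $T(\lambda+x)=\lambda+T(x)$; it is \emph{finitely generated} if each of its coordinates is a min-max function, i.e. is obtained from the variables $x_1,\dots,x_n$ by finitely many operations $\max$, $\min$ and addition of a real constant. Let $\mathbb{R}_{\max}=(\mathbb{R}\cup\{-\infty\},\max,+)$ and $\mathbb{R}_{\min}=(\mathbb{R}\cup\{+\infty\},\min,+)$. Let $E^{\max}$ be the set of vectors of $\mathbb{R}^n$ of the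 form $\sup_{f\in E}(\lambda_f+f)$ with $\lambda_f\in\mathbb{R}_{\max}$ not all equal to $-\infty$, the family being bounded above, and let $\bar E^{\max}\subset\mathbb{R}_{\max}^n$ be the set of limits of nonincreasing sequences of elements of $E^{\max}$ (for the metric $\max_i|e^{x_i}-e^{y_i}|$). Dually, let $E^{\min}$ be the set of vectors of $\mathbb{R}^n$ of the form $\inf_{f\in E}(\lambda_f+f)$ with $\lambda_f\in\mathbb{R}_{\min}$ not all equal to $+\infty$, the family being bounded below, and let $\bar E^{\min}\subset\mathbb{R}_{\min}^n$ be the set of limits of nondecreasing sequences of elements of $E^{\min}$ (for the metric $\max_i|e^{-x_i}-e^{-y_i}|$). \textbf{Theorem.} Let $E$ be a non-empty subset of $\mathbb{R}^n$. The following are equivalent: \begin{enumerate} \item $E$ is an ambitropical polyhedron; \item there is a finitely generated Shapley operator $P:\mathbb{R}^n\to\mathbb{R}^n$ such that $P=P\circ P$ and $E=\{x\in\mathbb{R}^n\mid x=P(x)\}$; \item there is a finitely generated Shapley operator $T:\mathbb{R}^n\to\mathbb{R}^n$ such that $E=\{x\in\mathbb{R}^n\mid x=T(x)\}$; \item $E$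 is an ambitropical cone, closed in the Euclidean topology, and $\bar E^{\max}$ and $\bar E^{\min}$ are finitely generated semimodules over $\mathbb{R}_{\max}$ and $\mathbb{R}_{\min}$, respectively. \end{enumerate} -/

import Mathlib

open Filter Topology

namespace Ambitropical

/-! Vectors of `ℝⁿ` are functions `Fin n → ℝ` with the coordinatewise order (their topology is the
Euclidean one).  The tropical semifield `ℝ ∪ {-∞}` is `WithBot ℝ`, with `⊔` as addition and `+` as
multiplication; its dual `ℝ ∪ {+∞}` is `WithTop ℝ`, with `⊓` and `+`. -/

/-- The inclusion of `ℝⁿ` in `(ℝ ∪ {-∞})ⁿ`. -/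
def toMax {n : ℕ} (x : Fin n → ℝ) : Fin n → WithBot ℝ := fun i => (x i : WithBot ℝ)

/-- The inclusion of `ℝⁿ` in `(ℝ ∪ {+∞})ⁿ`. -/
def toMin {n : ℕ} (x : Fin n → ℝ) : Fin n → WithTop ℝ := fun i => (x i : WithTop ℝ)

/-! ### Ambitropical cones and polyhedra -/

/-- `C` is stable by the addition of a real constant to all coordinates. -/
def IsAdditiveCone {n : ℕ} (C : Set (Fin n → ℝ)) : Prop :=
  ∀ x ∈ C, ∀ c : ℝ, (fun i => c + x i) ∈ C

/-- Ambitropical cone: a non-empty additive cone which is a lattice in the induced order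
(joins and meets are taken inside `C`; they need not be the ones of `ℝⁿ`). -/
structure IsAmbitropicalCone {n : ℕ} (C : Set (Fin n → ℝ)) : Prop where
  nonempty : C.Nonempty
  additive : IsAdditiveCone C
  exists_join : ∀ x ∈ C, ∀ y ∈ C, ∃ z, IsLeast {w | w ∈ C ∧ x ≤ w ∧ y ≤ w} z
  exists_meet : ∀ x ∈ C, ∀ y ∈ C, ∃ z, IsGreatest {w | w ∈ C ∧ w ≤ x ∧ w ≤ y} z

/-- The set of `x` with `x i ≥ M i j + x j` for all `i, j`, where `M` has entries in `ℝ ∪ {-∞}`. -/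
def alcoved {n : ℕ} (M : Matrix (Fin n) (Fin n) (WithBot ℝ)) : Set (Fin n → ℝ) :=
  {x | ∀ i j, M i j + (x j : WithBot ℝ) ≤ (x i : WithBot ℝ)}

def IsAlcovedPolyhedron {n : ℕ} (A : Set (Fin n → ℝ)) : Prop :=
  ∃ M : Matrix (Fin n) (Fin n) (WithBot ℝ), A = alcoved M

/-- Ambitropical polyhedron: an ambitropical cone that is a finite union of alcoved polyhedra. -/
def IsAmbitropicalPolyhedron {n : ℕ} (E : Set (Fin n → ℝ)) : Prop :=
  IsAmbitropicalCone E ∧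
    ∃ S : Set (Set (Fin n → ℝ)), S.Finite ∧ (∀ A ∈ S, IsAlcovedPolyhedron A) ∧ E = ⋃₀ S

/-! ### Finitely generated Shapley operators -/

/-- Abstract Shapley operator: order preserving and commuting with the addition of a constant. -/
structure IsShapleyOperator {n p : ℕ} (T : (Fin n → ℝ) → (Fin p → ℝ)) : Prop where
  monotone : ∀ x y, x ≤ y → T x ≤ T y
  add_const : ∀ (c : ℝ) (x : Fin n → ℝ), T (fun i => c + x i) = fun i => c + T x i

/-- Min-max functions of `x₁, …, xₙ`, i.e. the functions defined by the terms of the grammar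
`X → x₁, …, xₙ, X ∨ X, X ∧ X, X + c` with `c` a real constant. -/
inductive IsMinMaxFunction {n : ℕ} : ((Fin n → ℝ) → ℝ) → Prop
  | var (i : Fin n) : IsMinMaxFunction (fun x => x i)
  | max {f g : (Fin n → ℝ) → ℝ} (hf : IsMinMaxFunction f) (hg : IsMinMaxFunction g) :
      IsMinMaxFunction (fun x => f x ⊔ g x)
  | min {f g : (Fin n → ℝ) → ℝ} (hf : IsMinMaxFunction f) (hg : IsMinMaxFunction g) :
      IsMinMaxFunction (fun x => f x ⊓ g x)
  | add_const {f : (Fin n → ℝ) → ℝ} (hf : IsMinMaxFunction f) (c : ℝ) :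
      IsMinMaxFunction (fun x => f x + c)

/-- Finitely generated Shapley operator: its coordinates are min-max functions. -/
structure IsFinGenShapleyOperator {n p : ℕ} (T : (Fin n → ℝ) → (Fin p → ℝ)) : Prop
    extends IsShapleyOperator T where
  coord : ∀ i, IsMinMaxFunction (fun x => T x i)

/-! ### Lower and upper closures -/

/-- The exponential on `ℝ ∪ {-∞}`, with `exp (-∞) = 0`. -/
noncomputable def expMax : WithBot ℝ → ℝ
  | ⊥ => 0
  | (a : ℝ) => Real.exp a

/-- The map `a ↦ exp (-a)` on `ℝ ∪ {+∞}`, with `exp (-∞) = 0`. -/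
noncomputable def expMin : WithTop ℝ → ℝ
  | ⊤ => 0
  | (a : ℝ) => Real.exp (-a)

/-- The metric `max_i |exp (x i) - exp (y i)|` on `(ℝ ∪ {-∞})ⁿ` (`dist` is the one of the sup-norm
on `Fin n → ℝ`). -/
noncomputable def distMax {n : ℕ} (x y : Fin n → WithBot ℝ) : ℝ :=
  dist (fun i => expMax (x i)) (fun i => expMax (y i))

/-- The metric `max_i |exp (-x i) - exp (-y i)|` on `(ℝ ∪ {+∞})ⁿ`. -/
noncomputable def distMin {n : ℕ} (x y : Fin n → WithTop ℝ) : ℝ :=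
  dist (fun i => expMin (x i)) (fun i => expMin (y i))

/-- The lower closure of `C ⊆ ℝⁿ`: limits in `(ℝ ∪ {-∞})ⁿ` of nonincreasing sequences of `C`. -/
def lowerClosureMax {n : ℕ} (C : Set (Fin n → ℝ)) : Set (Fin n → WithBot ℝ) :=
  {v | ∃ x : ℕ → Fin n → ℝ, (∀ k, x k ∈ C) ∧ Antitone x ∧
    Tendsto (fun k => distMax (toMax (x k)) v) atTop (𝓝 0)}

/-- The upper closure of `C ⊆ ℝⁿ`: limits in `(ℝ ∪ {+∞})ⁿ` of nondecreasing sequences of `C`. -/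
def upperClosureMin {n : ℕ} (C : Set (Fin n → ℝ)) : Set (Fin n → WithTop ℝ) :=
  {v | ∃ x : ℕ → Fin n → ℝ, (∀ k, x k ∈ C) ∧ Monotone x ∧
    Tendsto (fun k => distMin (toMin (x k)) v) atTop (𝓝 0)}

/-! ### Tropical hulls -/

/-- `E^max`: the vectors of `ℝⁿ` of the form `sup {c_f + f | f ∈ E}` with coefficients `c_f` in
`ℝ ∪ {-∞}`, not all equal to `-∞`. (Such a supremum is a vector of `ℝⁿ`
only if the family is bounded above.) -/
def maxHull {n : ℕ} (E : Set (Fin n → ℝ)) : Set (Fin n → ℝ) :=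
  {x | ∃ c : E → WithBot ℝ, (∃ f, c f ≠ ⊥) ∧
    IsLUB (Set.range fun (f : E) (i : Fin n) => c f + toMax f.1 i) (toMax x)}

/-- `E^min`: the vectors of `ℝⁿ` of the form `inf {c_f + f | f ∈ E}` with coefficients `c_f` in
`ℝ ∪ {+∞}`, not all equal to `+∞`. -/
def minHull {n : ℕ} (E : Set (Fin n → ℝ)) : Set (Fin n → ℝ) :=
  {x | ∃ c : E → WithTop ℝ, (∃ f, c f ≠ ⊤) ∧
    IsGLB (Set.range fun (f : E) (i : Fin n) => c f + toMin f.1 i) (toMin x)}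

/-! ### Finitely generated semimodules over the tropical semifields -/

/-- Subsemimodules of `(ℝ ∪ {-∞})ⁿ` over the max-plus semifield. -/
structure IsMaxSubsemimodule {n : ℕ} (V : Set (Fin n → WithBot ℝ)) : Prop where
  zero_mem : (fun _ => ⊥) ∈ V
  sup_mem : ∀ u ∈ V, ∀ v ∈ V, (fun i => u i ⊔ v i) ∈ V
  smul_mem : ∀ c : WithBot ℝ, ∀ v ∈ V, (fun i => c + v i) ∈ V

/-- Subsemimodules of `(ℝ ∪ {+∞})ⁿ` over the min-plus semifield. -/
structure IsMinSubsemimodule {n : ℕ} (V : Set (Fin n → WithTop ℝ)) : Prop where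
  zero_mem : (fun _ => ⊤) ∈ V
  inf_mem : ∀ u ∈ V, ∀ v ∈ V, (fun i => u i ⊓ v i) ∈ V
  smul_mem : ∀ c : WithTop ℝ, ∀ v ∈ V, (fun i => c + v i) ∈ V

/-- `V` is a finitely generated max-plus semimodule: a subsemimodule of `(ℝ ∪ {-∞})ⁿ` with a finite
subset `G` such that every element of `V` is a tropical linear combination of elements of `G`. -/
def IsFinGenMaxSemimodule {n : ℕ} (V : Set (Fin n → WithBot ℝ)) : Prop :=
  IsMaxSubsemimodule V ∧ ∃ G : Finset (Fin n → WithBot ℝ), (∀ g ∈ G, g ∈ V) ∧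
    ∀ v ∈ V, ∃ c : (Fin n → WithBot ℝ) → WithBot ℝ, v = fun i => G.sup fun g => c g + g i

/-- `V` is a finitely generated min-plus semimodule. -/
def IsFinGenMinSemimodule {n : ℕ} (V : Set (Fin n → WithTop ℝ)) : Prop :=
  IsMinSubsemimodule V ∧ ∃ G : Finset (Fin n → WithTop ℝ), (∀ g ∈ G, g ∈ V) ∧
    ∀ v ∈ V, ∃ c : (Fin n → WithTop ℝ) → WithTop ℝ, v = fun i => G.inf fun g => c g + g i

end Ambitropical

open Ambitropical

/-!
A finitely generated Shapley operator `T` has a fixed-point set that is a lattice by the argument of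
Knaster and Tarski (`IsShapleyOperator.exists_join`). It is a finite union of alcoved polyhedra,
because `{x | c + x i ≤ f x}` and `{x | f x ≤ c + x i}` are such unions for every min-max function
`f`, by induction on `f` (`IsMinMaxFunction.isFiniteUnionOfAlcoved`).

Conversely, let `E` be an ambitropical cone.

If `E` is a finite union of non-empty alcoved polyhedra `A`, it is closed, and the lower closure of
its max-plus hull is generated by the columns of the matrices `D i j = inf {y i - y j | y ∈ A}`.
Each column is a limit of a nonincreasing sequence of `A`. A vector `x ∈ A` is reached at
coordinate `i` by the multiple of the `i`-th column that lies below it, and this property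
(`IsReachedBy`) passes to suprema and to limits by a pigeonhole argument on the finitely many
columns.

If the two closures are finitely generated, `Q x = sup {y ∈ E | y ≤ x}` is a tuple of min-max
functions of `x`, being the supremum over the generators `g` of the largest multiple of `g` below
`x` (`exists_isMinMaxFunction_isLUB`); so is `R x = inf {y ∈ E | x ≤ y}`. The composition `R ∘ Q`
fixes `E`, and takes its values in `E` when `E` is closed, because `R (Q x)` is then the join in `E`
of all the elements of `E` below `x` (`IsAmbitropicalCone.isGLB_mem`). This is the projection.

The statements on min-plus hulls are deduced from those on max-plus hulls by the symmetry
`x ↦ -x` (`isFinGenMinSemimodule_upperClosureMin_iff`).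
-/

namespace Ambitropical

/-! ### Min-max functions -/

section MinMax

variable {n : ℕ} {f : (Fin n → ℝ) → ℝ}

theorem IsMinMaxFunction.monotone (hf : IsMinMaxFunction f) : Monotone f := by
  induction hf with
  | var i => exact fun x y h => h i
  | max _ _ h₁ h₂ => exact fun x y h => sup_le_sup (h₁ h) (h₂ h)
  | min _ _ h₁ h₂ => exact fun x y h => inf_le_inf (h₁ h) (h₂ h)
  | add_const _ c h₁ => exact fun x y h => add_le_add_left (h₁ h) c

theorem IsMinMaxFunction.apply_const_add (hf : IsMinMaxFunction f) (c : ℝ) (x : Fin n → ℝ) :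
    f (fun i => c + x i) = c + f x := by
  induction hf with
  | var i => rfl
  | max _ _ h₁ h₂ => simp only [h₁, h₂, max_add_add_left]
  | min _ _ h₁ h₂ => simp only [h₁, h₂, min_add_add_left]
  | add_const _ d h₁ => simp only [h₁, add_assoc]

theorem IsMinMaxFunction.comp {m : ℕ} (hf : IsMinMaxFunction f) {T : (Fin m → ℝ) → Fin n → ℝ}
    (hT : ∀ i, IsMinMaxFunction fun x => T x i) : IsMinMaxFunction fun x => f (T x) := by
  induction hf with
  | var i => exact hT i
  | max _ _ h₁ h₂ => exact h₁.max h₂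
  | min _ _ h₁ h₂ => exact h₁.min h₂
  | add_const _ c h₁ => exact h₁.add_const c

theorem IsMinMaxFunction.neg_comp_neg (hf : IsMinMaxFunction f) :
    IsMinMaxFunction fun x => -f (-x) := by
  induction hf with
  | var i => simpa using IsMinMaxFunction.var i
  | max _ _ h₁ h₂ => simpa only [neg_sup] using h₁.min h₂
  | min _ _ h₁ h₂ => simpa only [neg_inf] using h₁.max h₂
  | add_const _ c h₁ => simpa only [neg_add] using h₁.add_const (-c)

theorem IsMinMaxFunction.finset_sup' {ι : Type*} {s : Finset ι} (hs : s.Nonempty)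
    {F : ι → (Fin n → ℝ) → ℝ} (hF : ∀ a ∈ s, IsMinMaxFunction (F a)) :
    IsMinMaxFunction fun x => s.sup' hs fun a => F a x := by
  induction hs using Finset.Nonempty.cons_induction with
  | singleton a => simpa using hF a
  | cons a s ha hs ih =>
    simp only [Finset.sup'_cons hs]
    exact (hF a (by simp)).max (ih fun b hb => hF b (by simp [hb]))

theorem IsMinMaxFunction.finset_inf' {ι : Type*} {s : Finset ι} (hs : s.Nonempty)
    {F : ι → (Fin n → ℝ) → ℝ} (hF : ∀ a ∈ s, IsMinMaxFunction (F a)) :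
    IsMinMaxFunction fun x => s.inf' hs fun a => F a x := by
  induction hs using Finset.Nonempty.cons_induction with
  | singleton a => simpa using hF a
  | cons a s ha hs ih =>
    simp only [Finset.inf'_cons hs]
    exact (hF a (by simp)).min (ih fun b hb => hF b (by simp [hb]))

theorem IsFinGenShapleyOperator.of_coord {p : ℕ} {T : (Fin n → ℝ) → Fin p → ℝ}
    (hT : ∀ i, IsMinMaxFunction fun x => T x i) : IsFinGenShapleyOperator T where
  monotone _ _ h i := (hT i).monotone h
  add_const c x := funext fun i => (hT i).apply_const_add c x
  coord := hT

end MinMax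

/-! ### Finite unions of alcoved polyhedra -/

section Alcoved

variable {n : ℕ}

/-- `E` is the union of a finite set of alcoved polyhedra. -/
def IsFiniteUnionOfAlcoved (E : Set (Fin n → ℝ)) : Prop :=
  ∃ S : Set (Set (Fin n → ℝ)), S.Finite ∧ (∀ A ∈ S, IsAlcovedPolyhedron A) ∧ E = ⋃₀ S

theorem mem_alcoved {M : Matrix (Fin n) (Fin n) (WithBot ℝ)} {x : Fin n → ℝ} :
    x ∈ alcoved M ↔ ∀ i j, M i j + (x j : WithBot ℝ) ≤ (x i : WithBot ℝ) := Iff.rfl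

theorem IsAlcovedPolyhedron.isFiniteUnionOfAlcoved {A : Set (Fin n → ℝ)}
    (hA : IsAlcovedPolyhedron A) : IsFiniteUnionOfAlcoved A :=
  ⟨{A}, Set.finite_singleton A, by simpa using hA, by simp⟩

theorem isAlcovedPolyhedron_univ : IsAlcovedPolyhedron (Set.univ : Set (Fin n → ℝ)) :=
  ⟨fun _ _ => ⊥, (Set.eq_univ_of_forall fun x i j => by simp).symm⟩

theorem isAlcovedPolyhedron_halfSpace (c : ℝ) (i j : Fin n) :
    IsAlcovedPolyhedron {x : Fin n → ℝ | c + x j ≤ x i} := by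
  refine ⟨Matrix.of fun a b => if a = i ∧ b = j then (c : WithBot ℝ) else ⊥, ?_⟩
  ext x
  simp only [Set.mem_ofPred_eq, mem_alcoved, Matrix.of_apply]
  constructor
  · intro h a b
    split_ifs with hab
    · rw [hab.1, hab.2]
      exact_mod_cast h
    · simp
  · intro h
    have := h i j
    simp only [and_self, if_true] at this
    exact_mod_cast this

theorem IsAlcovedPolyhedron.inter {A B : Set (Fin n → ℝ)} (hA : IsAlcovedPolyhedron A)
    (hB : IsAlcovedPolyhedron B) : IsAlcovedPolyhedron (A ∩ B) := by
  obtain ⟨M, rfl⟩ := hA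
  obtain ⟨N, rfl⟩ := hB
  refine ⟨Matrix.of fun i j => M i j ⊔ N i j, ?_⟩
  ext x
  simp only [Set.mem_inter_iff, mem_alcoved, Matrix.of_apply, max_add, sup_le_iff, forall_and]

theorem IsFiniteUnionOfAlcoved.union {A B : Set (Fin n → ℝ)} (hA : IsFiniteUnionOfAlcoved A)
    (hB : IsFiniteUnionOfAlcoved B) : IsFiniteUnionOfAlcoved (A ∪ B) := by
  obtain ⟨S, hS, hSA, rfl⟩ := hA
  obtain ⟨S', hS', hSB, rfl⟩ := hB
  refine ⟨S ∪ S', hS.union hS', ?_, (Set.sUnion_union S S').symm⟩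
  rintro C (hC | hC)
  exacts [hSA C hC, hSB C hC]

theorem IsFiniteUnionOfAlcoved.inter {A B : Set (Fin n → ℝ)} (hA : IsFiniteUnionOfAlcoved A)
    (hB : IsFiniteUnionOfAlcoved B) : IsFiniteUnionOfAlcoved (A ∩ B) := by
  obtain ⟨S, hS, hSA, rfl⟩ := hA
  obtain ⟨S', hS', hSB, rfl⟩ := hB
  refine ⟨Set.image2 (· ∩ ·) S S', hS.image2 _ hS', ?_, ?_⟩
  · rintro _ ⟨C, hC, D, hD, rfl⟩
    exact (hSA C hC).inter (hSB D hD)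
  · ext x
    simp only [Set.mem_inter_iff, Set.mem_sUnion, Set.mem_image2]
    constructor
    · rintro ⟨⟨C, hC, hx⟩, D, hD, hx'⟩
      exact ⟨_, ⟨C, hC, D, hD, rfl⟩, hx, hx'⟩
    · rintro ⟨_, ⟨C, hC, D, hD, rfl⟩, hx, hx'⟩
      exact ⟨⟨C, hC, hx⟩, D, hD, hx'⟩

theorem IsFiniteUnionOfAlcoved.biInter {ι : Type*} (s : Finset ι) {A : ι → Set (Fin n → ℝ)}
    (hA : ∀ a ∈ s, IsFiniteUnionOfAlcoved (A a)) : IsFiniteUnionOfAlcoved (⋂ a ∈ s, A a) := by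
  classical
  induction s using Finset.induction_on with
  | empty => simpa using isAlcovedPolyhedron_univ.isFiniteUnionOfAlcoved
  | insert a s _ ih =>
    rw [Finset.set_biInter_insert]
    exact (hA a (by simp)).inter (ih fun b hb => hA b (by simp [hb]))

/-- The sublevel and superlevel sets of a min-max function, relative to a translated variable, are
finite unions of alcoved polyhedra: maxima and minima turn into unions and intersections. -/
theorem IsMinMaxFunction.isFiniteUnionOfAlcoved {f : (Fin n → ℝ) → ℝ} (hf : IsMinMaxFunction f)
    (c : ℝ) (i : Fin n) :
    IsFiniteUnionOfAlcoved {x | c + x i ≤ f x} ∧ IsFiniteUnionOfAlcoved {x | f x ≤ c + x i} := by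
  induction hf generalizing c with
  | var j =>
    refine ⟨(isAlcovedPolyhedron_halfSpace c j i).isFiniteUnionOfAlcoved, ?_⟩
    convert (isAlcovedPolyhedron_halfSpace (-c) i j).isFiniteUnionOfAlcoved using 3
    simp
  | max _ _ h₁ h₂ =>
    constructor
    · simpa only [le_sup_iff, Set.ofPred_or] using (h₁ c).1.union (h₂ c).1
    · simpa only [sup_le_iff, Set.ofPred_and] using (h₁ c).2.inter (h₂ c).2
  | min _ _ h₁ h₂ =>
    constructor
    · simpa only [le_inf_iff, Set.ofPred_and] using (h₁ c).1.inter (h₂ c).1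
    · simpa only [inf_le_iff, Set.ofPred_or] using (h₁ c).2.union (h₂ c).2
  | add_const _ d h₁ =>
    constructor
    · convert (h₁ (c - d)).1 using 3
      constructor <;> intro h <;> linarith
    · convert (h₁ (c - d)).2 using 3
      constructor <;> intro h <;> linarith

theorem IsFinGenShapleyOperator.isFiniteUnionOfAlcoved_fixedPoints
    {T : (Fin n → ℝ) → Fin n → ℝ} (hT : IsFinGenShapleyOperator T) :
    IsFiniteUnionOfAlcoved {x | x = T x} := by
  have h := IsFiniteUnionOfAlcoved.biInter Finset.univ fun i _ =>
    ((hT.coord i).isFiniteUnionOfAlcoved 0 i).1.inter ((hT.coord i).isFiniteUnionOfAlcoved 0 i).2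
  convert h using 1
  ext x
  simp [le_antisymm_iff, Pi.le_def, forall_and]

theorem IsAlcovedPolyhedron.isClosed {A : Set (Fin n → ℝ)} (hA : IsAlcovedPolyhedron A) :
    IsClosed A := by
  obtain ⟨M, rfl⟩ := hA
  simp only [alcoved, Set.ofPred_forall]
  refine isClosed_iInter fun i => isClosed_iInter fun j => ?_
  cases h : M i j with
  | bot => simp
  | coe m =>
    norm_cast
    exact isClosed_le (by fun_prop) (by fun_prop)

theorem IsFiniteUnionOfAlcoved.isClosed {E : Set (Fin n → ℝ)} (hE : IsFiniteUnionOfAlcoved E) :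
    IsClosed E := by
  obtain ⟨S, hS, hA, rfl⟩ := hE
  rw [Set.sUnion_eq_biUnion]
  exact hS.isClosed_biUnion fun A h => (hA A h).isClosed

theorem IsAlcovedPolyhedron.neg_preimage {A : Set (Fin n → ℝ)} (hA : IsAlcovedPolyhedron A) :
    IsAlcovedPolyhedron (Neg.neg ⁻¹' A) := by
  obtain ⟨M, rfl⟩ := hA
  refine ⟨M.transpose, ?_⟩
  ext x
  simp only [Set.mem_preimage, mem_alcoved, Matrix.transpose_apply]
  rw [forall_comm]
  refine forall₂_congr fun i j => ?_
  cases M j i with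
  | bot => simp
  | coe m =>
    simp only [Pi.neg_apply]
    norm_cast
    constructor <;> intro h <;> linarith

theorem IsFiniteUnionOfAlcoved.neg_preimage {E : Set (Fin n → ℝ)}
    (hE : IsFiniteUnionOfAlcoved E) : IsFiniteUnionOfAlcoved (Neg.neg ⁻¹' E) := by
  obtain ⟨S, hS, hA, rfl⟩ := hE
  refine ⟨Set.preimage Neg.neg '' S, hS.image _, ?_, ?_⟩
  · rintro _ ⟨A, h, rfl⟩
    exact (hA A h).neg_preimage
  · rw [Set.sUnion_image, Set.preimage_sUnion]

end Alcoved

/-! ### Fixed points of Shapley operators -/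

section FixedPoints

variable {n : ℕ}

theorem exists_le_const_add (x y : Fin n → ℝ) : ∃ c : ℝ, x ≤ fun i => c + y i := by
  obtain ⟨c, hc⟩ := (Set.finite_range fun i => x i - y i).bddAbove
  exact ⟨c, fun i => by linarith [hc ⟨i, rfl⟩]⟩

/-- The least super-fixed point above `x ⊔ y` is the join of `x` and `y` among the fixed points:
this is the argument of Knaster and Tarski, `ℝⁿ` being conditionally complete and the translates of
`x` providing super-fixed points above `x ⊔ y`. -/
theorem IsShapleyOperator.exists_join {T : (Fin n → ℝ) → Fin n → ℝ} (hT : IsShapleyOperator T)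
    {x y : Fin n → ℝ} (hx : x = T x) (hy : y = T y) :
    ∃ z, IsLeast {w | w ∈ {x | x = T x} ∧ x ≤ w ∧ y ≤ w} z := by
  -- The infimum of the super-fixed points is taken in `ℝⁿ`; it is again a super-fixed point.
  set U : Set (Fin n → ℝ) := {w | T w ≤ w ∧ x ≤ w ∧ y ≤ w} with hU
  have hne : U.Nonempty := by
    obtain ⟨c, hc⟩ := exists_le_const_add (x ⊔ y) x
    refine ⟨fun i => c + x i, ?_, le_sup_left.trans hc, le_sup_right.trans hc⟩
    rw [hT.add_const, ← hx]
  have hglb : IsGLB U (sInf U) := isGLB_csInf hne ⟨x, fun w hw => hw.2.1⟩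
  have hxm : x ≤ sInf U := hglb.2 fun w hw => hw.2.1
  have hym : y ≤ sInf U := hglb.2 fun w hw => hw.2.2
  have hTm : T (sInf U) ≤ sInf U :=
    hglb.2 fun w hw => (hT.monotone _ _ (hglb.1 hw)).trans hw.1
  refine ⟨sInf U, ⟨le_antisymm (hglb.1 ⟨hT.monotone _ _ hTm, ?_, ?_⟩) hTm, hxm, hym⟩, ?_⟩
  · exact hx.le.trans (hT.monotone _ _ hxm)
  · exact hy.le.trans (hT.monotone _ _ hym)
  · rintro w ⟨hw, hw'⟩
    exact hglb.1 ⟨Eq.ge hw, hw'⟩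

theorem IsShapleyOperator.neg_comp_neg {T : (Fin n → ℝ) → Fin n → ℝ}
    (hT : IsShapleyOperator T) : IsShapleyOperator fun x => -T (-x) where
  monotone x y h := neg_le_neg (hT.monotone _ _ (neg_le_neg h))
  add_const c x := by
    have : (-fun i => c + x i) = fun i => -c + (-x) i := by
      funext i
      simp [add_comm]
    funext i
    show -T (-fun i => c + x i) i = c + -T (-x) i
    rw [this, congrFun (hT.add_const (-c) (-x)) i]
    ring

theorem IsShapleyOperator.isAmbitropicalCone_fixedPoints {T : (Fin n → ℝ) → Fin n → ℝ}
    (hT : IsShapleyOperator T) (hne : {x | x = T x}.Nonempty) :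
    IsAmbitropicalCone {x | x = T x} where
  nonempty := hne
  additive x hx c := by
    have hx : x = T x := hx
    show _ = T _
    rw [hT.add_const, ← hx]
  exists_join x hx y hy := hT.exists_join hx hy
  exists_meet x hx y hy := by
    have hx : x = T x := hx
    have hy : y = T y := hy
    obtain ⟨z, ⟨hz, hxz, hyz⟩, hle⟩ := hT.neg_comp_neg.exists_join (x := -x) (y := -y)
      (by simpa using hx) (by simpa using hy)
    refine ⟨-z, ⟨?_, neg_le.mp hxz, neg_le.mp hyz⟩, ?_⟩
    · exact neg_eq_iff_eq_neg.mpr hz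
    · rintro w ⟨hw, hwx, hwy⟩
      refine le_neg.mp (hle ⟨?_, neg_le_neg hwx, neg_le_neg hwy⟩)
      have hw : w = T w := hw
      simpa using hw

end FixedPoints

/-! ### Lower closures -/

section LowerClosure

variable {n : ℕ}

theorem expMax_strictMono : StrictMono expMax := by
  intro a b hab
  cases b with
  | bot => simp at hab
  | coe b =>
    cases a with
    | bot => exact Real.exp_pos b
    | coe a => exact Real.exp_lt_exp.mpr (by exact_mod_cast hab)

theorem exists_expMax_eq {t : ℝ} (ht : 0 ≤ t) : ∃ b, expMax b = t := by
  rcases ht.eq_or_lt with rfl | ht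
  · exact ⟨⊥, rfl⟩
  · exact ⟨(Real.log t : ℝ), Real.exp_log ht⟩

theorem tendsto_exp_expMax_iff_isGLB {a : ℕ → ℝ} (ha : Antitone a) (b : WithBot ℝ) :
    Tendsto (fun k => Real.exp (a k)) atTop (𝓝 (expMax b)) ↔
      IsGLB (Set.range fun k => (a k : WithBot ℝ)) b := by
  have hanti : Antitone fun k => Real.exp (a k) := fun _ _ h => Real.exp_le_exp.mpr (ha h)
  have key : ∀ b, Tendsto (fun k => Real.exp (a k)) atTop (𝓝 (expMax b)) →
      IsGLB (Set.range fun k => (a k : WithBot ℝ)) b := by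
    intro b h
    have hglb := isGLB_of_tendsto_atTop hanti h
    constructor
    · rintro _ ⟨k, rfl⟩
      exact expMax_strictMono.le_iff_le.mp (hglb.1 ⟨k, rfl⟩)
    · intro c hc
      refine expMax_strictMono.le_iff_le.mp (hglb.2 ?_)
      rintro _ ⟨k, rfl⟩
      exact expMax_strictMono.monotone (hc ⟨k, rfl⟩)
  refine ⟨key b, fun h => ?_⟩
  -- The exponentials have some limit, and `key` forces it to be `expMax` of the infimum.
  have hbdd : BddBelow (Set.range fun k => Real.exp (a k)) :=
    ⟨0, by rintro _ ⟨k, rfl⟩; exact (Real.exp_pos _).le⟩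
  have hlim := tendsto_atTop_ciInf hanti hbdd
  obtain ⟨b', hb'⟩ := exists_expMax_eq (le_ciInf fun k => (Real.exp_pos (a k)).le)
  rw [← hb'] at hlim
  rwa [h.unique (key b' hlim)]

/-- Convergence of a nonincreasing sequence for `distMax` is the same as convergence to its
coordinatewise infimum in `ℝ ∪ {-∞}`. -/
theorem mem_lowerClosureMax_iff {C : Set (Fin n → ℝ)} {v : Fin n → WithBot ℝ} :
    v ∈ lowerClosureMax C ↔ ∃ x : ℕ → Fin n → ℝ, (∀ k, x k ∈ C) ∧ Antitone x ∧
      ∀ i, IsGLB (Set.range fun k => (x k i : WithBot ℝ)) (v i) := by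
  refine exists_congr fun x => and_congr_right fun _ => and_congr_right fun hx => ?_
  have hx' : ∀ i, Antitone fun k => x k i := fun i _ _ h => hx h i
  simp only [distMax, ← tendsto_iff_dist_tendsto_zero, tendsto_pi_nhds]
  exact forall_congr' fun i => tendsto_exp_expMax_iff_isGLB (hx' i) (v i)

theorem subset_lowerClosureMax {C : Set (Fin n → ℝ)} {x : Fin n → ℝ} (hx : x ∈ C) :
    toMax x ∈ lowerClosureMax C :=
  mem_lowerClosureMax_iff.mpr ⟨fun _ => x, fun _ => hx, antitone_const, fun i => by
    simp [Set.range_const, toMax]⟩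

theorem lowerClosureMax_mono {C D : Set (Fin n → ℝ)} (h : C ⊆ D) :
    lowerClosureMax C ⊆ lowerClosureMax D :=
  fun _ ⟨x, hx, hx'⟩ => ⟨x, fun k => h (hx k), hx'⟩

theorem coe_add_le_iff (c : ℝ) (a b : WithBot ℝ) :
    (c : WithBot ℝ) + a ≤ b ↔ a ≤ ((-c : ℝ) : WithBot ℝ) + b := by
  cases a with
  | bot => simp
  | coe a =>
    cases b with
    | bot => simp [← WithBot.coe_add]
    | coe b =>
      norm_cast
      constructor <;> intro h <;> linarith

theorem le_coe_add_iff (c : ℝ) (a b : WithBot ℝ) :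
    a ≤ (c : WithBot ℝ) + b ↔ ((-c : ℝ) : WithBot ℝ) + a ≤ b := by
  rw [coe_add_le_iff, neg_neg]

end LowerClosure

/-! ### Max-plus hulls -/

section MaxHull

variable {n : ℕ} {E : Set (Fin n → ℝ)}

theorem mem_maxHull_iff {x : Fin n → ℝ} :
    x ∈ maxHull E ↔ ∃ c : E → WithBot ℝ, (∃ f, c f ≠ ⊥) ∧
      ∀ i, IsLUB (Set.range fun f : E => c f + (f.1 i : WithBot ℝ)) (x i : WithBot ℝ) := by
  refine exists_congr fun c => and_congr_right fun _ => ?_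
  rw [isLUB_pi]
  refine forall_congr' fun i => ?_
  rw [← Set.range_comp]
  rfl

theorem subset_maxHull : E ⊆ maxHull E := by
  classical
  intro x hx
  refine mem_maxHull_iff.mpr ⟨fun f => if f = ⟨x, hx⟩ then 0 else ⊥,
    ⟨⟨x, hx⟩, by simp⟩, fun i => ?_⟩
  constructor
  · rintro _ ⟨f, rfl⟩
    by_cases h : f = ⟨x, hx⟩
    · simp [h]
    · simp [h]
  · intro b hb
    simpa using hb ⟨⟨x, hx⟩, rfl⟩

theorem sup_mem_maxHull {x y : Fin n → ℝ} (hx : x ∈ maxHull E) (hy : y ∈ maxHull E) :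
    x ⊔ y ∈ maxHull E := by
  obtain ⟨c, ⟨f, hf⟩, hc⟩ := mem_maxHull_iff.mp hx
  obtain ⟨d, -, hd⟩ := mem_maxHull_iff.mp hy
  refine mem_maxHull_iff.mpr ⟨fun f => c f ⊔ d f,
    ⟨f, fun h => hf (max_eq_bot.mp h).1⟩, fun i => ?_⟩
  constructor
  · rintro _ ⟨f, rfl⟩
    simp only [max_add, Pi.sup_apply, WithBot.coe_max]
    exact sup_le_sup ((hc i).1 ⟨f, rfl⟩) ((hd i).1 ⟨f, rfl⟩)
  · intro b hb
    simp only [Pi.sup_apply, WithBot.coe_max]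
    refine sup_le ((hc i).2 ?_) ((hd i).2 ?_)
    · rintro _ ⟨f, rfl⟩
      exact le_trans (add_le_add_left le_sup_left _) (hb ⟨f, rfl⟩)
    · rintro _ ⟨f, rfl⟩
      exact le_trans (add_le_add_left le_sup_right _) (hb ⟨f, rfl⟩)

theorem const_add_mem_maxHull {x : Fin n → ℝ} (hx : x ∈ maxHull E) (a : ℝ) :
    (fun i => a + x i) ∈ maxHull E := by
  obtain ⟨c, ⟨f, hf⟩, hc⟩ := mem_maxHull_iff.mp hx
  refine mem_maxHull_iff.mpr ⟨fun f => a + c f, ⟨f, by simpa using hf⟩, fun i => ?_⟩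
  constructor
  · rintro _ ⟨f, rfl⟩
    rw [WithBot.coe_add]
    simp only [add_assoc]
    exact add_le_add_right ((hc i).1 ⟨f, rfl⟩) _
  · intro b hb
    rw [WithBot.coe_add, coe_add_le_iff]
    refine (hc i).2 ?_
    rintro _ ⟨f, rfl⟩
    rw [le_coe_add_iff, neg_neg, ← add_assoc]
    exact hb ⟨f, rfl⟩

theorem isMaxSubsemimodule_lowerClosureMax (hE : E.Nonempty) :
    IsMaxSubsemimodule (lowerClosureMax (maxHull E)) := by
  have zero : (fun _ => ⊥) ∈ lowerClosureMax (maxHull E) := by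
    obtain ⟨x, hx⟩ := hE
    refine mem_lowerClosureMax_iff.mpr ⟨fun k i => -k + x i,
      fun k => const_add_mem_maxHull (subset_maxHull hx) _, ?_,
      fun i => ⟨by simp [lowerBounds], ?_⟩⟩
    · intro k l h i
      have : (k : ℝ) ≤ l := by exact_mod_cast h
      show -(l : ℝ) + x i ≤ -k + x i
      linarith
    · intro b hb
      cases b with
      | bot => exact le_rfl
      | coe b =>
        obtain ⟨k, hk⟩ := exists_nat_gt (x i - b)
        have : (b : WithBot ℝ) ≤ (-k + x i : ℝ) := hb ⟨k, rfl⟩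
        have : b ≤ -k + x i := by exact_mod_cast this
        linarith
  refine ⟨zero, ?_, ?_⟩
  · intro u hu v hv
    obtain ⟨x, hx, hxa, hxu⟩ := mem_lowerClosureMax_iff.mp hu
    obtain ⟨y, hy, hya, hyv⟩ := mem_lowerClosureMax_iff.mp hv
    refine mem_lowerClosureMax_iff.mpr ⟨fun k => x k ⊔ y k,
      fun k => sup_mem_maxHull (hx k) (hy k), hxa.sup hya, fun i => ⟨?_, ?_⟩⟩
    · rintro _ ⟨k, rfl⟩
      simp only [Pi.sup_apply, WithBot.coe_max]
      exact sup_le_sup ((hxu i).1 ⟨k, rfl⟩) ((hyv i).1 ⟨k, rfl⟩)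
    · intro b hb
      -- As both sequences are nonincreasing, a common index makes both terms smaller than `b`.
      by_contra! h
      obtain ⟨hub, hvb⟩ := max_lt_iff.mp h
      obtain ⟨_, ⟨k, rfl⟩, hk⟩ := (isGLB_lt_iff (hxu i)).mp hub
      obtain ⟨_, ⟨l, rfl⟩, hl⟩ := (isGLB_lt_iff (hyv i)).mp hvb
      have hb' := hb ⟨max k l, rfl⟩
      simp only [Pi.sup_apply, WithBot.coe_max] at hb'
      refine absurd hb' (not_le.mpr (max_lt ?_ ?_))
      · exact lt_of_le_of_lt (WithBot.coe_le_coe.mpr (hxa (le_max_left k l) i)) hk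
      · exact lt_of_le_of_lt (WithBot.coe_le_coe.mpr (hya (le_max_right k l) i)) hl
  · intro c v hv
    cases c with
    | bot => simpa using zero
    | coe c =>
      obtain ⟨x, hx, hxa, hxv⟩ := mem_lowerClosureMax_iff.mp hv
      refine mem_lowerClosureMax_iff.mpr ⟨fun k i => c + x k i,
        fun k => const_add_mem_maxHull (hx k) c,
        fun k l h i => add_le_add_right (hxa h i) c, fun i => ⟨?_, ?_⟩⟩
      · rintro _ ⟨k, rfl⟩
        simp only [WithBot.coe_add]
        exact add_le_add_right ((hxv i).1 ⟨k, rfl⟩) _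
      · intro b hb
        rw [le_coe_add_iff]
        refine (hxv i).2 ?_
        rintro _ ⟨k, rfl⟩
        rw [coe_add_le_iff, neg_neg, ← WithBot.coe_add]
        exact hb ⟨k, rfl⟩

end MaxHull

/-! ### Generators of a lower closure -/

section Generators

variable {n : ℕ}

/-- The vector `v` is reached at every coordinate `i` by a multiple of an element `g` of `G` lying
below `v`. The coefficient `v i - g i` of that multiple is removed by adding `g i` on both sides,
so that no subtraction in `ℝ ∪ {-∞}` is needed. -/
def IsReachedBy (G : Set (Fin n → WithBot ℝ)) (v : Fin n → WithBot ℝ) : Prop :=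
  ∀ i, ∃ g ∈ G, g i ≠ ⊥ ∧ ∀ j, v i + g j ≤ v j + g i

theorem IsReachedBy.mono {G H : Set (Fin n → WithBot ℝ)} {v : Fin n → WithBot ℝ}
    (h : IsReachedBy G v) (hGH : G ⊆ H) : IsReachedBy H v := fun i =>
  let ⟨g, hg, h'⟩ := h i
  ⟨g, hGH hg, h'⟩

/-- A vector reached at each coordinate by a generator is a tropical linear combination: the
coefficient of `g` is the supremum of `v i - g i` over the coordinates `i` at which `g` is used. -/
theorem IsReachedBy.exists_coeff {G : Finset (Fin n → WithBot ℝ)} {v : Fin n → WithBot ℝ}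
    (h : IsReachedBy (G : Set (Fin n → WithBot ℝ)) v) :
    ∃ c : (Fin n → WithBot ℝ) → WithBot ℝ, v = fun i => G.sup fun g => c g + g i := by
  classical
  choose γ hγ hne hle using h
  choose r hr using fun i => WithBot.ne_bot_iff_exists.mp (hne i)
  have hmain : ∀ i j, ((-r i : ℝ) : WithBot ℝ) + v i + γ i j ≤ v j := by
    intro i j
    rw [add_assoc, coe_add_le_iff, neg_neg, hr, add_comm (γ i i)]
    exact hle i j
  refine ⟨fun g => (Finset.univ.filter fun i => γ i = g).sup
    fun i => ((-r i : ℝ) : WithBot ℝ) + v i,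
    funext fun j => le_antisymm ?_ (Finset.sup_le fun g _ => ?_)⟩
  · refine le_trans ?_ (Finset.le_sup (f := fun g => (Finset.univ.filter fun i => γ i = g).sup
      (fun i => ((-r i : ℝ) : WithBot ℝ) + v i) + g j) (hγ j))
    have hj : ((-r j : ℝ) : WithBot ℝ) + v j ≤ (Finset.univ.filter fun i => γ i = γ j).sup
        fun i => ((-r i : ℝ) : WithBot ℝ) + v i :=
      Finset.le_sup (f := fun i => ((-r i : ℝ) : WithBot ℝ) + v i) (by simp)
    refine le_trans ?_ (add_le_add_left hj _)
    rw [← hr, add_comm _ (r j : WithBot ℝ), ← add_assoc, ← WithBot.coe_add]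
    simp
  · rcases (Finset.univ.filter fun i => γ i = g).eq_empty_or_nonempty with he | hne
    · simp [he]
    · obtain ⟨i, hi, hsup⟩ := Finset.exists_mem_eq_sup _ hne fun i => ((-r i : ℝ) : WithBot ℝ) + v i
      obtain rfl := (Finset.mem_filter.mp hi).2
      simp only [hsup]
      exact hmain i j

/-- A supremum over `E` need not be attained, so a generator is first found up to an error `ε > 0`;
as there are finitely many generators, one of them serves for arbitrarily small errors. -/
theorem isReachedBy_maxHull {E : Set (Fin n → ℝ)} {G : Finset (Fin n → WithBot ℝ)}
    (hG : ∀ x ∈ E, IsReachedBy (G : Set (Fin n → WithBot ℝ)) (toMax x)) {x : Fin n → ℝ}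
    (hx : x ∈ maxHull E) : IsReachedBy (G : Set (Fin n → WithBot ℝ)) (toMax x) := by
  obtain ⟨c, -, hc⟩ := mem_maxHull_iff.mp hx
  intro i
  have hε : ∀ ε > (0 : ℝ), ∃ g ∈ G, g i ≠ ⊥ ∧
      ∀ j, ((x i - ε : ℝ) : WithBot ℝ) + g j ≤ x j + g i := by
    intro ε hε
    have hlt : ((x i - ε : ℝ) : WithBot ℝ) < x i := by exact_mod_cast sub_lt_self _ hε
    obtain ⟨_, ⟨f, rfl⟩, hf⟩ := (lt_isLUB_iff (hc i)).mp hlt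
    obtain ⟨g, hg, hgi, hle⟩ := hG f.1 f.2 i
    refine ⟨g, hg, hgi, fun j => ?_⟩
    calc ((x i - ε : ℝ) : WithBot ℝ) + g j ≤ c f + f.1 i + g j := add_le_add_left hf.le _
      _ = c f + (f.1 i + g j) := add_assoc _ _ _
      _ ≤ c f + (f.1 j + g i) := add_le_add_right (hle j) _
      _ = c f + f.1 j + g i := (add_assoc _ _ _).symm
      _ ≤ x j + g i := add_le_add_left ((hc j).1 ⟨f, rfl⟩) _
  have hfreq : ∃ᶠ ε in 𝓝[>] (0 : ℝ), ∃ g ∈ G, g i ≠ ⊥ ∧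
      ∀ j, ((x i - ε : ℝ) : WithBot ℝ) + g j ≤ x j + g i :=
    Eventually.frequently (eventually_mem_nhdsWithin.mono fun ε h => hε ε h)
  obtain ⟨g, hg, hfr⟩ := (frequently_exists_finset G).mp hfreq
  refine ⟨g, hg, hfr.exists.choose_spec.1, fun j => ?_⟩
  obtain ⟨a, ha⟩ := WithBot.ne_bot_iff_exists.mp hfr.exists.choose_spec.1
  rw [← ha] at hfr ⊢
  cases hb : g j with
  | bot => simp
  | coe b =>
    simp only [toMax]
    norm_cast
    refine le_of_forall_pos_lt_add fun δ hδ => ?_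
    obtain ⟨ε, ⟨-, hle⟩, hεδ⟩ := (hfr.and_eventually
      (eventually_nhdsWithin_of_eventually_nhds (Iio_mem_nhds hδ))).exists
    have h := hle j
    rw [hb] at h
    norm_cast at h
    have : ε < δ := hεδ
    linarith

/-- Along a nonincreasing sequence, one of the finitely many generators serves infinitely often, and
the inequalities it satisfies pass to the infimum. -/
theorem isReachedBy_lowerClosureMax {C : Set (Fin n → ℝ)} {G : Finset (Fin n → WithBot ℝ)}
    (hG : ∀ x ∈ C, IsReachedBy (G : Set (Fin n → WithBot ℝ)) (toMax x)) {v : Fin n → WithBot ℝ}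
    (hv : v ∈ lowerClosureMax C) : IsReachedBy (G : Set (Fin n → WithBot ℝ)) v := by
  obtain ⟨x, hx, hxa, hxv⟩ := mem_lowerClosureMax_iff.mp hv
  intro i
  have hfreq : ∃ᶠ k in (atTop : Filter ℕ), ∃ g ∈ G, g i ≠ ⊥ ∧
      ∀ j, toMax (x k) i + g j ≤ toMax (x k) j + g i :=
    (Eventually.of_forall fun k => hG (x k) (hx k) i).frequently
  obtain ⟨g, hg, hfr⟩ := (frequently_exists_finset G).mp hfreq
  obtain ⟨a, ha⟩ := WithBot.ne_bot_iff_exists.mp hfr.exists.choose_spec.1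
  refine ⟨g, hg, hfr.exists.choose_spec.1, fun j => ?_⟩
  rw [← ha, add_comm (v j), le_coe_add_iff]
  refine (hxv j).2 ?_
  rintro _ ⟨k, rfl⟩
  obtain ⟨l, hkl, -, hl⟩ := (frequently_atTop.mp hfr) k
  have hlj := hl j
  rw [← ha, add_comm (toMax (x l) j), le_coe_add_iff] at hlj
  calc ((-a : ℝ) : WithBot ℝ) + (v i + g j) ≤ ((-a : ℝ) : WithBot ℝ) + (toMax (x l) i + g j) := by
        gcongr
        exact (hxv i).1 ⟨l, rfl⟩
    _ ≤ toMax (x l) j := hlj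
    _ ≤ x k j := WithBot.coe_le_coe.mpr (hxa hkl j)

/-- The infimum of `y i - y j` over `y ∈ A`, equal to `-∞` when these differences are not bounded
below, stated by its universal property among the `r` such that `r + y j ≤ y i` on `A`. -/
theorem exists_greatest_weight {A : Set (Fin n → ℝ)} (hA : A.Nonempty) (i j : Fin n) :
    ∃ d : WithBot ℝ, ∀ r : WithBot ℝ, r ≤ d ↔ ∀ y ∈ A, r + (y j : WithBot ℝ) ≤ y i := by
  by_cases hb : BddBelow ((fun y : Fin n → ℝ => y i - y j) '' A)
  · refine ⟨(sInf ((fun y : Fin n → ℝ => y i - y j) '' A) : ℝ), fun r => ?_⟩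
    cases r with
    | bot => simp
    | coe r =>
      norm_cast
      rw [le_csInf_iff hb (hA.image _)]
      simp only [Set.forall_mem_image, le_sub_iff_add_le]
  · refine ⟨⊥, fun r => ?_⟩
    cases r with
    | bot => simp
    | coe r =>
      simp only [le_bot_iff, WithBot.coe_ne_bot, false_iff]
      intro h
      refine hb ⟨r, ?_⟩
      rintro _ ⟨y, hy, rfl⟩
      have := h y hy
      norm_cast at this
      exact le_sub_iff_add_le.mpr this

/-- An alcoved polyhedron is generated by the columns of the matrix `D i j = inf (y i - y j)`, the
tightest one defining it; each column is the limit of the least elements of the polyhedron above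
vectors whose coordinates other than the `j`-th tend to `-∞`. -/
theorem IsAlcovedPolyhedron.exists_generators {A : Set (Fin n → ℝ)} (hA : IsAlcovedPolyhedron A) :
    ∃ G : Finset (Fin n → WithBot ℝ), (∀ g ∈ G, g ∈ lowerClosureMax A) ∧
      ∀ x ∈ A, IsReachedBy (G : Set (Fin n → WithBot ℝ)) (toMax x) := by
  classical
  rcases A.eq_empty_or_nonempty with rfl | hne
  · exact ⟨∅, by simp, by simp⟩
  obtain ⟨M, rfl⟩ := hA
  choose D hD using fun i j => exists_greatest_weight hne i j
  have hDle : ∀ i j, ∀ y ∈ alcoved M, D i j + (y j : WithBot ℝ) ≤ y i := fun i j =>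
    (hD i j _).mp le_rfl
  have hdiag : ∀ i, 0 ≤ D i i := fun i => (hD i i _).mpr fun y _ => by simp
  have hMD : ∀ i j, M i j ≤ D i j := fun i j => (hD i j _).mpr fun y hy => hy i j
  have htri : ∀ i j k, D i j + D j k ≤ D i k := fun i j k => (hD i k _).mpr fun y hy => by
    rw [add_assoc]
    exact (add_le_add_right (hDle j k y hy) _).trans (hDle i j y hy)
  have hdiag_ne : ∀ i, D i i ≠ ⊥ := fun i => ne_bot_of_le_ne_bot (by simp) (hdiag i)
  refine ⟨Finset.univ.image fun j i => D i j, ?_, ?_⟩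
  · simp only [Finset.mem_image, Finset.mem_univ, true_and, forall_exists_index,
      forall_apply_eq_imp_iff]
    intro j
    -- `e k` is `0` at `j` and `-k` elsewhere, and `y k` is the least element of `A` above it.
    let e : ℕ → Fin n → ℝ := fun k l => if l = j then 0 else -k
    let Y : ℕ → Fin n → WithBot ℝ := fun k i => Finset.univ.sup fun l => D i l + (e k l : WithBot ℝ)
    have hY : ∀ k i l, D i l + (e k l : WithBot ℝ) ≤ Y k i := fun k i l =>
      Finset.le_sup (f := fun l => D i l + (e k l : WithBot ℝ)) (Finset.mem_univ l)
    have hYne : ∀ k i, Y k i ≠ ⊥ := fun k i =>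
      ne_bot_of_le_ne_bot (by simpa using hdiag_ne i) (hY k i i)
    choose y hy using fun k i => WithBot.ne_bot_iff_exists.mp (hYne k i)
    refine mem_lowerClosureMax_iff.mpr ⟨y, fun k => mem_alcoved.mpr fun i l => ?_, ?_,
      fun i => ⟨?_, ?_⟩⟩
    · rw [hy, hy]
      obtain ⟨m, -, hm⟩ := Finset.exists_mem_eq_sup Finset.univ ⟨l, Finset.mem_univ l⟩
        fun m => D l m + (e k m : WithBot ℝ)
      have hm : Y k l = D l m + (e k m : WithBot ℝ) := hm
      rw [hm, ← add_assoc]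
      refine le_trans ?_ (hY k i m)
      gcongr
      exact (add_le_add_left (hMD i l) _).trans (htri i l m)
    · intro k l hkl i
      rw [← WithBot.coe_le_coe, hy, hy]
      refine Finset.sup_mono_fun fun m _ => ?_
      gcongr
      have : (k : ℝ) ≤ l := by exact_mod_cast hkl
      refine WithBot.coe_le_coe.mpr ?_
      simp only [e]
      split_ifs <;> linarith
    · rintro _ ⟨k, rfl⟩
      simp only [hy]
      simpa [e] using hY k i j
    · intro b hb
      -- All the terms of the supremum `y k i` but the `j`-th one are at most `K - k`.
      by_contra! hlt
      obtain ⟨b, rfl⟩ := WithBot.ne_bot_iff_exists.mp (ne_bot_of_gt hlt)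
      obtain ⟨K, hK⟩ : ∃ K : ℝ, ∀ l, D i l ≤ K :=
        ⟨(Finset.univ.sup (D i)).unbotD 0, fun l =>
          (Finset.le_sup (Finset.mem_univ l)).trans (WithBot.le_coe_unbotD _ _)⟩
      obtain ⟨k, hk⟩ := exists_nat_gt (K - b)
      have hbk : (b : WithBot ℝ) ≤ Y k i := hy k i ▸ hb ⟨k, rfl⟩
      refine absurd hbk (not_le.mpr ((Finset.sup_lt_iff (WithBot.bot_lt_coe b)).mpr fun l _ => ?_))
      by_cases hl : l = j
      · simpa [e, hl] using hlt
      · simp only [e, hl, if_false]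
        refine (add_le_add_left (hK l) _).trans_lt ?_
        rw [← WithBot.coe_add, WithBot.coe_lt_coe]
        linarith
  · intro x hx i
    refine ⟨fun l => D l i, by simp, hdiag_ne i, fun j => ?_⟩
    calc toMax x i + D j i = D j i + x i := add_comm _ _
      _ ≤ toMax x j := hDle j i x hx
      _ ≤ toMax x j + D i i := le_add_of_nonneg_right (hdiag i)

theorem IsFiniteUnionOfAlcoved.isFinGenMaxSemimodule {E : Set (Fin n → ℝ)}
    (hE : IsFiniteUnionOfAlcoved E) (hne : E.Nonempty) :
    IsFinGenMaxSemimodule (lowerClosureMax (maxHull E)) := by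
  refine ⟨isMaxSubsemimodule_lowerClosureMax hne, ?_⟩
  obtain ⟨S, hS, hA, rfl⟩ := hE
  have : Finite S := hS
  choose G hG hGA using fun A : S => (hA A.1 A.2).exists_generators
  have hfin : (⋃ A, (G A : Set (Fin n → WithBot ℝ))).Finite :=
    Set.finite_iUnion fun A => (G A).finite_toSet
  refine ⟨hfin.toFinset, ?_, fun v hv => ?_⟩
  · simp only [Set.Finite.mem_toFinset, Set.mem_iUnion, Finset.mem_coe]
    rintro g ⟨A, hg⟩
    exact lowerClosureMax_mono ((Set.subset_sUnion_of_mem A.2).trans subset_maxHull) (hG A g hg)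
  · refine (isReachedBy_lowerClosureMax (fun x hx => isReachedBy_maxHull ?_ hx) hv).exists_coeff
    rintro y ⟨A, hAS, hy⟩
    refine (hGA ⟨A, hAS⟩ y hy).mono ?_
    rw [Set.Finite.coe_toFinset]
    exact Set.subset_iUnion (fun A => (G A : Set (Fin n → WithBot ℝ))) ⟨A, hAS⟩

end Generators

/-! ### Duality between max-plus and min-plus -/

section Duality

variable {n : ℕ}

/-- The negation `ℝ ∪ {-∞} → ℝ ∪ {+∞}`, an order-reversing isomorphism of tropical semifields. -/
def negEquiv : WithBot ℝ ≃ WithTop ℝ where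
  toFun a := a.recBotCoe ⊤ fun r => ((-r : ℝ) : WithTop ℝ)
  invFun a := a.recTopCoe ⊥ fun r => ((-r : ℝ) : WithBot ℝ)
  left_inv a := by
    cases a with
    | bot => rfl
    | coe a => exact congrArg WithBot.some (neg_neg a)
  right_inv a := by
    cases a with
    | top => rfl
    | coe a => exact congrArg WithTop.some (neg_neg a)

@[simp] theorem negEquiv_bot : negEquiv ⊥ = ⊤ := rfl

@[simp] theorem negEquiv_coe (r : ℝ) : negEquiv (r : WithBot ℝ) = ((-r : ℝ) : WithTop ℝ) := rfl

theorem negEquiv_le_negEquiv {a b : WithBot ℝ} : negEquiv a ≤ negEquiv b ↔ b ≤ a := by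
  cases a with
  | bot => cases b <;> simp
  | coe a =>
    cases b with
    | bot => simp
    | coe b => rw [negEquiv_coe, negEquiv_coe, WithTop.coe_le_coe, WithBot.coe_le_coe,
        neg_le_neg_iff]

theorem negEquiv_add (a b : WithBot ℝ) : negEquiv (a + b) = negEquiv a + negEquiv b := by
  cases a with
  | bot => simp
  | coe a =>
    cases b with
    | bot => simp
    | coe b =>
      rw [← WithBot.coe_add, negEquiv_coe, neg_add, WithTop.coe_add]
      rfl

theorem negEquiv_antitone : Antitone negEquiv := fun _ _ h => negEquiv_le_negEquiv.mpr h

theorem negEquiv_sup (a b : WithBot ℝ) : negEquiv (a ⊔ b) = negEquiv a ⊓ negEquiv b :=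
  negEquiv_antitone.map_sup a b

theorem negEquiv_finset_sup {ι : Type*} (s : Finset ι) (f : ι → WithBot ℝ) :
    negEquiv (s.sup f) = s.inf fun a => negEquiv (f a) := by
  classical
  induction s using Finset.induction_on with
  | empty => simp
  | insert a s _ ih => rw [Finset.sup_insert, Finset.inf_insert, negEquiv_sup, ih]

theorem expMin_negEquiv (a : WithBot ℝ) : expMin (negEquiv a) = expMax a := by
  cases a with
  | bot => rfl
  | coe a =>
    show Real.exp (- -a) = Real.exp a
    rw [neg_neg]

/-- Coordinatewise negation `(ℝ ∪ {-∞})ⁿ → (ℝ ∪ {+∞})ⁿ`. -/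
def negVec : (Fin n → WithBot ℝ) ≃ (Fin n → WithTop ℝ) := Equiv.piCongrRight fun _ => negEquiv

@[simp] theorem negVec_apply (v : Fin n → WithBot ℝ) (i : Fin n) :
    negVec v i = negEquiv (v i) := rfl

theorem negVec_toMax (x : Fin n → ℝ) : negVec (toMax x) = toMin (-x) := rfl

theorem negVec_le_negVec {u v : Fin n → WithBot ℝ} : negVec u ≤ negVec v ↔ v ≤ u :=
  forall_congr' fun _ => negEquiv_le_negEquiv

theorem isGLB_image_negVec {s : Set (Fin n → WithBot ℝ)} {a : Fin n → WithBot ℝ} :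
    IsGLB (negVec '' s) (negVec a) ↔ IsLUB s a := by
  have hmem : ∀ b, negVec b ∈ lowerBounds (negVec '' s) ↔ b ∈ upperBounds s := fun b => by
    simp only [lowerBounds, upperBounds, Set.forall_mem_image, negVec_le_negVec, Set.mem_ofPred_eq]
  refine and_congr (hmem a) ?_
  show (∀ b, b ∈ lowerBounds (negVec '' s) → b ≤ negVec a) ↔ ∀ b, b ∈ upperBounds s → a ≤ b
  rw [negVec.surjective.forall]
  simp only [hmem, negVec_le_negVec]

theorem neg_mem_maxHull_neg_iff {E : Set (Fin n → ℝ)} {x : Fin n → ℝ} :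
    -x ∈ maxHull (Neg.neg ⁻¹' E) ↔ x ∈ minHull E := by
  let e : (Neg.neg ⁻¹' E : Set (Fin n → ℝ)) ≃ E :=
    ⟨fun f => ⟨-f.1, f.2⟩, fun f => ⟨-f.1, by simp⟩, fun f => by simp, fun f => by simp⟩
  refine Equiv.exists_congr (Equiv.arrowCongr e negEquiv) fun c => and_congr ?_ ?_
  · refine Equiv.exists_congr e fun f => not_congr ?_
    rw [Equiv.arrowCongr_apply, Function.comp_apply, Function.comp_apply, Equiv.symm_apply_apply,
      ← negEquiv_bot, negEquiv.apply_eq_iff_eq]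
  · rw [← isGLB_image_negVec, negVec_toMax, neg_neg, ← Set.range_comp, ← e.surjective.range_comp]
    have : (negVec ∘ fun (f : (Neg.neg ⁻¹' E : Set (Fin n → ℝ))) (i : Fin n) => c f + toMax f.1 i) =
        (fun (f : E) (i : Fin n) => Equiv.arrowCongr e negEquiv c f + toMin f.1 i) ∘ e := by
      funext f i
      simp only [Function.comp_apply, negVec_apply, negEquiv_add, Equiv.arrowCongr_apply,
        Equiv.symm_apply_apply]
      rfl
    rw [this]

theorem negVec_mem_upperClosureMin_iff {C : Set (Fin n → ℝ)} {v : Fin n → WithBot ℝ} :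
    negVec v ∈ upperClosureMin C ↔ v ∈ lowerClosureMax (Neg.neg ⁻¹' C) := by
  have hdist : ∀ x : Fin n → ℝ, distMin (toMin (-x)) (negVec v) = distMax (toMax x) v := fun x => by
    simp only [distMin, distMax, ← negVec_toMax, negVec_apply, expMin_negEquiv]
  constructor
  · rintro ⟨x, hx, hmono, hlim⟩
    refine ⟨fun k => -x k, fun k => by simpa using hx k, hmono.neg, ?_⟩
    simpa only [← hdist, neg_neg] using hlim
  · rintro ⟨x, hx, hanti, hlim⟩
    refine ⟨fun k => -x k, hx, hanti.neg, ?_⟩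
    simpa only [hdist] using hlim

theorem isFinGenMinSemimodule_iff {V : Set (Fin n → WithTop ℝ)} :
    IsFinGenMinSemimodule V ↔ IsFinGenMaxSemimodule (negVec ⁻¹' V) := by
  classical
  have hsup : ∀ u v : Fin n → WithBot ℝ,
      negVec (fun i => u i ⊔ v i) = fun i => negVec u i ⊓ negVec v i := fun u v =>
    funext fun i => negEquiv_sup _ _
  have hadd : ∀ (c : WithBot ℝ) (v : Fin n → WithBot ℝ),
      negVec (fun i => c + v i) = fun i => negEquiv c + negVec v i := fun c v =>
    funext fun i => negEquiv_add _ _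
  refine and_congr ⟨fun h => ⟨h.zero_mem, fun u hu v hv => ?_, fun c v hv => ?_⟩,
    fun h => ⟨h.zero_mem, ?_, ?_⟩⟩ ?_
  · rw [Set.mem_preimage, hsup]
    exact h.inf_mem _ hu _ hv
  · rw [Set.mem_preimage, hadd]
    exact h.smul_mem _ _ hv
  · simp only [negVec.surjective.forall, ← hsup]
    exact h.sup_mem
  · simp only [negVec.surjective.forall, negEquiv.surjective.forall, ← hadd]
    exact h.smul_mem
  · refine Equiv.exists_congr (Equiv.finsetCongr negVec.symm) fun G => and_congr ?_ ?_
    · rw [negVec.surjective.forall]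
      simp
    · rw [negVec.surjective.forall]
      refine forall₂_congr fun v _ => ?_
      refine Equiv.exists_congr (Equiv.arrowCongr negVec.symm negEquiv.symm) fun c => ?_
      rw [← negVec.apply_eq_iff_eq]
      refine Eq.congr rfl (funext fun i => ?_)
      rw [negVec_apply, negEquiv_finset_sup]
      simp [Finset.inf_map, negEquiv_add, Function.comp_def, ← negVec_apply]

theorem isFinGenMinSemimodule_upperClosureMin_iff {E : Set (Fin n → ℝ)} :
    IsFinGenMinSemimodule (upperClosureMin (minHull E)) ↔
      IsFinGenMaxSemimodule (lowerClosureMax (maxHull (Neg.neg ⁻¹' E))) := by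
  rw [isFinGenMinSemimodule_iff]
  have h : Neg.neg ⁻¹' minHull E = maxHull (Neg.neg ⁻¹' E) := by
    ext x
    rw [Set.mem_preimage, ← neg_mem_maxHull_neg_iff, neg_neg]
  have : negVec ⁻¹' upperClosureMin (minHull E) = lowerClosureMax (maxHull (Neg.neg ⁻¹' E)) := by
    ext v
    rw [Set.mem_preimage, negVec_mem_upperClosureMin_iff, h]
  rw [this]

end Duality

/-! ### Projections on finitely generated closures -/

section Projection

variable {n : ℕ} {E : Set (Fin n → ℝ)}

/-- The largest `r` such that the multiple of `g` with `i`-th coordinate `r` lies below `x` is a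
min-max function of `x`, namely the minimum of `x j - g j + g i` over the support of `g`. -/
theorem exists_residual {g : Fin n → WithBot ℝ} {i : Fin n} (hi : g i ≠ ⊥) :
    ∃ φ : (Fin n → ℝ) → ℝ, IsMinMaxFunction φ ∧
      ∀ x (r : ℝ), r ≤ φ x ↔ ∀ j, (r : WithBot ℝ) + g j ≤ x j + g i := by
  classical
  have hs : (Finset.univ.filter fun j => g j ≠ ⊥).Nonempty := ⟨i, by simpa using hi⟩
  obtain ⟨a, ha⟩ := WithBot.ne_bot_iff_exists.mp hi
  refine ⟨fun x => (Finset.univ.filter fun j => g j ≠ ⊥).inf' hs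
      fun j => x j + (a - (g j).unbotD 0),
    IsMinMaxFunction.finset_inf' hs fun j _ => (IsMinMaxFunction.var j).add_const _, fun x r => ?_⟩
  rw [Finset.le_inf'_iff, ← ha]
  simp only [Finset.mem_filter, Finset.mem_univ, true_and]
  refine forall_congr' fun j => ?_
  cases g j with
  | bot => simp
  | coe b =>
    simp only [ne_eq, WithBot.coe_ne_bot, not_false_eq_true, forall_const, WithBot.unbotD_coe]
    norm_cast
    constructor <;> intro h <;> linarith

/-- Elements of the lower closure below `x ∈ ℝⁿ` are approached, coordinate by coordinate, by
elements of the cone itself that lie below `x`. -/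
theorem exists_mem_le_of_mem_lowerClosureMax (hE : IsAdditiveCone E) {u : Fin n → WithBot ℝ}
    (hu : u ∈ lowerClosureMax (maxHull E)) {x : Fin n → ℝ} (hux : u ≤ toMax x) {i : Fin n} {r b : ℝ}
    (hr : u i = r) (hb : b < r) : ∃ y ∈ E, y ≤ x ∧ b < y i := by
  obtain ⟨z, hz, hza, hzu⟩ := mem_lowerClosureMax_iff.mp hu
  -- Half of the gap `r - b` is spent on shifting a term of the sequence below `x`, the other half
  -- on replacing the supremum over `E` by one of its terms.
  set ε : ℝ := (r - b) / 2 with hε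
  have hεpos : 0 < ε := by simp only [hε]; linarith
  have hex : ∀ j, ∃ k, z k j < x j + ε := fun j => by
    have : u j < (x j + ε : ℝ) :=
      (hux j).trans_lt (WithBot.coe_lt_coe.mpr (lt_add_of_pos_right _ hεpos))
    obtain ⟨_, ⟨k, rfl⟩, hk⟩ := (isGLB_lt_iff (hzu j)).mp this
    exact ⟨k, WithBot.coe_lt_coe.mp hk⟩
  choose k hk using hex
  have hzx : ∀ j, z (Finset.univ.sup k) j < x j + ε := fun j =>
    (hza (Finset.le_sup (Finset.mem_univ j)) j).trans_lt (hk j)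
  obtain ⟨c, -, hc⟩ := mem_maxHull_iff.mp (hz (Finset.univ.sup k))
  have hri : r ≤ z (Finset.univ.sup k) i := by
    have := (hzu i).1 ⟨Finset.univ.sup k, rfl⟩
    rw [hr] at this
    exact WithBot.coe_le_coe.mp this
  have hlt : ((b + ε : ℝ) : WithBot ℝ) < z (Finset.univ.sup k) i :=
    WithBot.coe_lt_coe.mpr (by simp only [hε]; linarith)
  obtain ⟨_, ⟨f, rfl⟩, hf⟩ := (lt_isLUB_iff (hc i)).mp hlt
  have hne : c f ≠ ⊥ := by
    intro h
    simp [h] at hf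
  obtain ⟨d, hd⟩ := WithBot.ne_bot_iff_exists.mp hne
  refine ⟨fun j => (d - ε) + f.1 j, hE f.1 f.2 _, fun j => ?_, ?_⟩
  · have h := (hc j).1 ⟨f, rfl⟩
    simp only [← hd] at h
    norm_cast at h
    linarith [hzx j]
  · simp only [← hd] at hf
    norm_cast at hf
    linarith

/-- When the lower closure of the max-plus hull of `E` is finitely generated, the supremum in `ℝⁿ`
of the elements of `E` below `x` is a tuple of min-max functions of `x`: it is the supremum over
the generators of their largest multiple below `x`. -/
theorem exists_isMinMaxFunction_isLUB (hne : E.Nonempty) (hE : IsAdditiveCone E)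
    (hV : IsFinGenMaxSemimodule (lowerClosureMax (maxHull E))) :
    ∃ Q : (Fin n → ℝ) → Fin n → ℝ, (∀ i, IsMinMaxFunction fun x => Q x i) ∧
      ∀ x, IsLUB {y | y ∈ E ∧ y ≤ x} (Q x) := by
  classical
  obtain ⟨hsub, G, hG, hgen⟩ := hV
  -- An element of `E` is reached at each coordinate by a multiple of a generator below it.
  have hreach : ∀ y ∈ E, ∀ i, ∃ g ∈ G, g i ≠ ⊥ ∧ ∀ j, (y i : WithBot ℝ) + g j ≤ y j + g i := by
    intro y hy i
    obtain ⟨c, hc⟩ := hgen _ (subset_lowerClosureMax (subset_maxHull hy))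
    have hyi : ∀ j, (y j : WithBot ℝ) = G.sup fun g => c g + g j := fun j => congrFun hc j
    have hGne : G.Nonempty := by
      rw [Finset.nonempty_iff_ne_empty]
      rintro rfl
      simpa using hyi i
    obtain ⟨g, hg, hsup⟩ := Finset.exists_mem_eq_sup G hGne fun g => c g + g i
    have hyg : (y i : WithBot ℝ) = c g + g i := (hyi i).trans hsup
    refine ⟨g, hg, fun h => by simp [h] at hyg, fun j => ?_⟩
    rw [hyg, add_right_comm]
    refine add_le_add_left ?_ _
    rw [hyi j]
    exact Finset.le_sup (f := fun g => c g + g j) hg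
  have hcoord : ∀ i, ∃ q : (Fin n → ℝ) → ℝ, IsMinMaxFunction q ∧
      ∀ x, IsLUB ((fun y : Fin n → ℝ => y i) '' {y | y ∈ E ∧ y ≤ x}) (q x) := by
    intro i
    have hs : (G.filter fun g => g i ≠ ⊥).Nonempty := by
      obtain ⟨y, hy⟩ := hne
      obtain ⟨g, hg, hgi, -⟩ := hreach y hy i
      exact ⟨g, Finset.mem_filter.mpr ⟨hg, hgi⟩⟩
    choose! φ hφ hφle using fun (g : Fin n → WithBot ℝ) (hg : g i ≠ ⊥) => exists_residual hg
    refine ⟨fun x => (G.filter fun g => g i ≠ ⊥).sup' hs fun g => φ g x,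
      IsMinMaxFunction.finset_sup' hs fun g hg => hφ g (Finset.mem_filter.mp hg).2,
      fun x => ⟨?_, ?_⟩⟩
    · rintro _ ⟨y, ⟨hy, hyx⟩, rfl⟩
      obtain ⟨g, hg, hgi, hle⟩ := hreach y hy i
      refine le_trans ?_ (Finset.le_sup' _ (Finset.mem_filter.mpr ⟨hg, hgi⟩))
      refine (hφle g hgi x (y i)).mpr fun j => (hle j).trans (add_le_add_left ?_ _)
      exact WithBot.coe_le_coe.mpr (hyx j)
    · intro b hb
      refine Finset.sup'_le hs _ fun g hg => le_of_forall_lt fun b' hb' => ?_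
      obtain ⟨hgG, hgi⟩ := Finset.mem_filter.mp hg
      obtain ⟨a, ha⟩ := WithBot.ne_bot_iff_exists.mp hgi
      have hle := (hφle g hgi x (φ g x)).mp le_rfl
      have hu := hsub.smul_mem ((φ g x - a : ℝ) : WithBot ℝ) g (hG g hgG)
      have hux : (fun j => ((φ g x - a : ℝ) : WithBot ℝ) + g j) ≤ toMax x := by
        intro j
        have hj := hle j
        rw [← ha, add_comm (x j : WithBot ℝ), le_coe_add_iff, ← add_assoc, ← WithBot.coe_add] at hj
        rwa [sub_eq_neg_add]
      have hui : ((φ g x - a : ℝ) : WithBot ℝ) + g i = φ g x := by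
        rw [← ha, ← WithBot.coe_add, sub_add_cancel]
      obtain ⟨y, hy, hyx, hby⟩ := exists_mem_le_of_mem_lowerClosureMax hE hu hux hui hb'
      exact hby.trans_le (hb ⟨y, ⟨hy, hyx⟩, rfl⟩)
  choose q hq hlub using hcoord
  refine ⟨fun x i => q i x, hq, fun x => isLUB_pi.mpr fun i => hlub i x⟩

theorem IsAdditiveCone.neg_preimage (hE : IsAdditiveCone E) :
    IsAdditiveCone (Neg.neg ⁻¹' E) := by
  intro x hx c
  have h := hE _ hx (-c)
  have heq : (-fun i => c + x i) = fun i => -c + (-x) i := by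
    funext i
    exact neg_add _ _
  rwa [Set.mem_preimage, heq]

theorem exists_isMinMaxFunction_isGLB (hne : E.Nonempty) (hE : IsAdditiveCone E)
    (hV : IsFinGenMinSemimodule (upperClosureMin (minHull E))) :
    ∃ Q : (Fin n → ℝ) → Fin n → ℝ, (∀ i, IsMinMaxFunction fun x => Q x i) ∧
      ∀ x, IsGLB {y | y ∈ E ∧ x ≤ y} (Q x) := by
  obtain ⟨x, hx⟩ := hne
  obtain ⟨Q, hQ, hlub⟩ := exists_isMinMaxFunction_isLUB ⟨-x, by simpa using hx⟩ hE.neg_preimage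
    (isFinGenMinSemimodule_upperClosureMin_iff.mp hV)
  refine ⟨fun x => -Q (-x), fun i => (hQ i).neg_comp_neg, fun x => ⟨?_, ?_⟩⟩
  · rintro y ⟨hy, hxy⟩
    exact neg_le.mp ((hlub (-x)).1 ⟨by simpa using hy, neg_le_neg hxy⟩)
  · intro b hb
    refine le_neg.mp ((hlub (-x)).2 ?_)
    rintro y ⟨hy, hyx⟩
    exact le_neg.mp (hb ⟨hy, le_neg.mp hyx⟩)

/-- In a closed ambitropical cone, the elements above the supremum in `ℝⁿ` of a part `S` have a
least element. The elements of the cone that lie below all the upper bounds of `S` in the cone form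
a directed set, so their supremum in `ℝⁿ` is a limit of them. -/
theorem IsAmbitropicalCone.isGLB_mem (hE : IsAmbitropicalCone E) (hcl : IsClosed E)
    {S : Set (Fin n → ℝ)} (hS : S ⊆ E) (hne : S.Nonempty) {z w : Fin n → ℝ} (hz : IsLUB S z)
    (hw : IsGLB {u | u ∈ E ∧ z ≤ u} w) : w ∈ E := by
  set J : Set (Fin n → ℝ) := {a | a ∈ E ∧ ∀ u ∈ E, z ≤ u → a ≤ u} with hJ
  have hSJ : S ⊆ J := fun y hy => ⟨hS hy, fun u _ hzu => (hz.1 hy).trans hzu⟩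
  obtain ⟨s, hs⟩ := hne
  obtain ⟨u₀, hu₀, hzu₀⟩ : ∃ u ∈ E, z ≤ u := by
    obtain ⟨c, hc⟩ := exists_le_const_add z s
    exact ⟨_, hE.additive s (hS hs) c, hc⟩
  have hdir : IsDirectedOrder J := ⟨by
    rintro ⟨a, ha, hau⟩ ⟨b, hb, hbu⟩
    obtain ⟨d, ⟨hd, had, hbd⟩, hleast⟩ := hE.exists_join a ha b hb
    exact ⟨⟨d, hd, fun u hu hzu => hleast ⟨hu, hau u hu hzu, hbu u hu hzu⟩⟩, had, hbd⟩⟩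
  have hJne : Nonempty J := ⟨⟨s, hSJ hs⟩⟩
  have hlub : IsLUB J (sSup J) := isLUB_csSup ⟨s, hSJ hs⟩ ⟨u₀, fun a ha => ha.2 u₀ hu₀ hzu₀⟩
  have htend : Tendsto (fun a : J => a.1) atTop (𝓝 (sSup J)) :=
    tendsto_atTop_isLUB (fun _ _ h => h) (by simpa using hlub)
  have hmem : sSup J ∈ E := hcl.mem_of_tendsto htend (Eventually.of_forall fun a => a.2.1)
  have hzs : z ≤ sSup J := hz.2 fun y hy => hlub.1 (hSJ hy)
  have hle : sSup J ≤ w := hw.2 fun u hu => hlub.2 fun a ha => ha.2 u hu.1 hu.2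
  rwa [le_antisymm (hw.1 ⟨hmem, hzs⟩) hle]

/-- The projection sends `x` to the infimum of the elements of `E` above the supremum of the
elements of `E` below `x`. -/
theorem IsAmbitropicalCone.exists_projection (hE : IsAmbitropicalCone E) (hcl : IsClosed E)
    (hmax : IsFinGenMaxSemimodule (lowerClosureMax (maxHull E)))
    (hmin : IsFinGenMinSemimodule (upperClosureMin (minHull E))) :
    ∃ P : (Fin n → ℝ) → Fin n → ℝ, IsFinGenShapleyOperator P ∧ P = P ∘ P ∧ E = {x | x = P x} := by
  obtain ⟨Q, hQ, hlub⟩ := exists_isMinMaxFunction_isLUB hE.nonempty hE.additive hmax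
  obtain ⟨R, hR, hglb⟩ := exists_isMinMaxFunction_isGLB hE.nonempty hE.additive hmin
  have hmem : ∀ x, R (Q x) ∈ E := by
    intro x
    refine hE.isGLB_mem hcl (fun y hy => hy.1) ?_ (hlub x) (hglb (Q x))
    obtain ⟨y, hy⟩ := hE.nonempty
    obtain ⟨c, hc⟩ := exists_le_const_add y x
    exact ⟨_, hE.additive y hy (-c), fun i => by linarith [hc i]⟩
  have hfix : ∀ x ∈ E, R (Q x) = x := by
    intro x hx
    have hQx : Q x = x := (hlub x).unique ⟨fun y hy => hy.2, fun b hb => hb ⟨hx, le_rfl⟩⟩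
    rw [hQx]
    exact (hglb x).unique ⟨fun y hy => hy.2, fun b hb => hb ⟨hx, le_rfl⟩⟩
  refine ⟨fun x => R (Q x), .of_coord fun i => (hR i).comp hQ,
    funext fun x => (hfix _ (hmem x)).symm, ?_⟩
  ext x
  exact ⟨fun hx => (hfix x hx).symm, fun hx => by
    have hx : x = R (Q x) := hx
    exact hx ▸ hmem x⟩

end Projection

end Ambitropical

theorem mainTheorem6 (n : ℕ) (E : Set (Fin n → ℝ)) (hE : E.Nonempty) :
    List.TFAE [
      IsAmbitropicalPolyhedron E,
      ∃ P : (Fin n → ℝ) → (Fin n → ℝ),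
        IsFinGenShapleyOperator P ∧ P = P ∘ P ∧ E = {x | x = P x},
      ∃ T : (Fin n → ℝ) → (Fin n → ℝ),
        IsFinGenShapleyOperator T ∧ E = {x | x = T x},
      IsClosed E ∧ IsAmbitropicalCone E ∧
        IsFinGenMaxSemimodule (lowerClosureMax (maxHull E)) ∧
        IsFinGenMinSemimodule (upperClosureMin (minHull E))] := by
  tfae_have 1 → 4 := by
    rintro ⟨hcone, hunion⟩
    have hunion : IsFiniteUnionOfAlcoved E := hunion
    obtain ⟨x, hx⟩ := hE
    exact ⟨hunion.isClosed, hcone, hunion.isFinGenMaxSemimodule ⟨x, hx⟩,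
      isFinGenMinSemimodule_upperClosureMin_iff.mpr
        (hunion.neg_preimage.isFinGenMaxSemimodule ⟨-x, by simpa using hx⟩)⟩
  tfae_have 4 → 2 := fun ⟨hcl, hcone, hmax, hmin⟩ => hcone.exists_projection hcl hmax hmin
  tfae_have 2 → 3 := fun ⟨P, hP, _, hEP⟩ => ⟨P, hP, hEP⟩
  tfae_have 3 → 1 := by
    rintro ⟨T, hT, rfl⟩
    exact ⟨hT.toIsShapleyOperator.isAmbitropicalCone_fixedPoints hE,
      hT.isFiniteUnionOfAlcoved_fixedPoints⟩
  tfae_finish
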